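/- Let $n\ge 1$, $0<\beta<1$, $\ell>0$, $0<t_0\le T$. Write $x=(x_1,x')\in\mathbb R\times\mathbb R^{n-1}$, let $D'\subset\mathbb R^{n-1}$ be a bounded open set and $\Omega=(0,\ell)\times D'\subset\mathbb R^n$. Put $$\alpha(x,y)=\frac{y-x}{|y-x|^{n/2+\beta+1}},\qquad \mathcal D^*(w)(x,y)=-(w(y)-w(x))\,\alpha(x,y),\qquad x,y\in\mathbb R^n ,$$ and let $\mathcal D(\nu)(x)=\int_{\mathbb R^n}(\nu(x,y)+\nu(y,x))\cdot\alpha(x,y)\,dy$ and, for $x\in\mathbb R^n\setminus\Omega$, $\mathcal N(\nu)(x)=-\int_{\mathbb R^n}(\nu(x,y)+\nu(y,x))\cdot\alpha(x,y)\,dy$. Let $$H^\beta(\mathbb R^n)=\Big\{w\in L^2(\mathbb R^n):\ |w|_{H^\beta}^2=\int_{\mathbb R^n}\int_{\mathbb R^n}\frac{(w(y)-w(x))^2}{|y-x|^{n+2\beta}}\,dy\,dx<\infty\Big\},$$ with norm $(\|w\|_{L^2}^2+|w|_{H^\beta}^2)^{1/2}$, and let $H^\beta_c(\mathbb R^n)$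 be the set of those $w\in H^\beta(\mathbb R^n)$ that are integrable with $\int_{\mathbb R^n}w\,dx=0$. Let $f=f(x',t)$ be a measurable function on $D'\times(0,T)$, independent of $x_1$, and let $u$ be a weak solution of $$\begin{cases}\partial_t u+\mathcal D(\mathcal D^*u)=f(x',t) & \text{in }\Omega\times(0,T),\\ \mathcal N(\mathcal D^*u)=0 & \text{in }(\mathbb R^n\setminus\Omega)\times(0,T),\\ u(\cdot,0)=0 & \text{in }\mathbb R^n,\end{cases}$$ that is, $u(\cdot,0)=0$ and for every $\phi\in H^\beta_c(\mathbb R^n)$ and almost every $t\in(0,T)$ the function $x\mapsto f(x',t)\phi(x)$ is integrable on $\Omega$ and $$\int_\Omega \partial_tu\,\phi\,dx+\int_{\mathbb R^n}\int_{\mathbb R^n}\mathcal D^*(u)\cdot\mathcal D^*(\phi)\,dy\,dx=\int_\Omega f\,\phi\,dx .$$ Assume that $u$ and its weak derivative $\partial_{x_1}u$ on $\mathbb R^n$ both belong to $C([0,T];H^\beta(\mathbb R^n))\cap H^1(0,T;L^2(\Omega))$ (no zero-mean condition on $u$ is needed). If $u=0$ almost everywhere in $\mathbb R^n\setminus\Omega$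 for every $t\in(0,t_0)$, then $f(x',t)=0$ for almost every $(x',t)\in D'\times(0,t_0)$. -/

import Mathlib

open MeasureTheory Set Filter Topology
open scoped ENNReal ContDiff

noncomputable section

namespace NonlocalDiffusion

/-- Euclidean space `ℝⁿ`. -/
abbrev E (n : ℕ) : Type := EuclideanSpace ℝ (Fin n)

/-- The space `L²(ℝⁿ)`. -/
abbrev L2 (n : ℕ) : Type := Lp ℝ 2 (volume : Measure (E n))

/-- The space `L²(Ω)`. -/
abbrev L2On {n : ℕ} (Ω : Set (E n)) : Type := Lp ℝ 2 ((volume : Measure (E n)).restrict Ω)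

/-- Restriction `L²(ℝⁿ) → L²(Ω)`. -/
def restrictL2 {n : ℕ} (Ω : Set (E n)) (w : L2 n) : L2On Ω :=
  LpToLpRestrictCLM (E n) ℝ ℝ volume 2 Ω w

/-- The antisymmetric kernel `α(x,y) = (y - x) / |y - x|^{n/2 + β + 1}` for a constant order `β`
and infinite interaction radius. -/
def alpha {n : ℕ} (β : ℝ) (x y : E n) : E n :=
  (‖y - x‖ ^ ((n : ℝ) / 2 + β + 1))⁻¹ • (y - x)

/-- The adjoint `𝒟*` of the nonlocal divergence: `𝒟*(w)(x,y) = -(w(y) - w(x)) α(x,y)`. -/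
def Dstar {n : ℕ} (β : ℝ) (w : E n → ℝ) (x y : E n) : E n :=
  (-(w y - w x)) • alpha β x y

/-- The interaction domain `Ω_I`: the points outside `Ω` that interact with points of `Ω`. -/
def interactionDomain {n : ℕ} (β : ℝ) (Ω : Set (E n)) : Set (E n) :=
  {y | y ∉ Ω ∧ ∃ x ∈ Ω, alpha β x y ≠ 0}

/-- The interaction domain is the whole complement, so that `Ω ∪ Ω_I = ℝⁿ`. For this reason all
spaces and integrals over `Ω ∪ Ω_I` are taken over `ℝⁿ` below. -/
theorem interactionDomain_eq_compl {n : ℕ} (β : ℝ) {Ω : Set (E n)} (hΩ : Ω.Nonempty) :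
    interactionDomain β Ω = Ωᶜ := by
  ext y
  refine ⟨fun h => h.1, fun h => ⟨h, ?_⟩⟩
  obtain ⟨x, hx⟩ := hΩ
  have hne : y - x ≠ 0 := by
    intro h0
    rw [sub_eq_zero] at h0
    exact h (h0 ▸ hx)
  refine ⟨x, hx, smul_ne_zero (inv_ne_zero ?_) hne⟩
  exact (Real.rpow_pos_of_pos (norm_pos_iff.mpr hne) _).ne'

/-- The bilinear form `∫∫ 𝒟*(w) · 𝒟*(φ) dy dx` over `ℝⁿ × ℝⁿ` (with `a ≡ 1`). -/
def energyForm {n : ℕ} (β : ℝ) (w φ : E n → ℝ) : ℝ :=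
  ∫ x, ∫ y, inner ℝ (Dstar β w x y) (Dstar β φ x y)

/-- The squared seminorm of `H^β(ℝⁿ)`:
`∫∫ (w(y) - w(x))² / |y - x|^{n + 2β} dy dx`, which is also `∫∫ |𝒟*(w)|² dy dx`. -/
def seminormSq {n : ℕ} (β : ℝ) (w : E n → ℝ) : ℝ≥0∞ :=
  ∫⁻ x, ∫⁻ y, ENNReal.ofReal ((w y - w x) ^ 2 / ‖y - x‖ ^ ((n : ℝ) + 2 * β))

/-- Membership of an `L²` function in `H^β(ℝⁿ)`. -/
def MemH {n : ℕ} (β : ℝ) (w : L2 n) : Prop :=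
  seminormSq β w < ⊤

/-- Membership in the constrained space of the Neumann case, which is `V_c = H^β_c`: functions in
`H^β(ℝⁿ)` whose integral exists and vanishes. -/
def MemHc {n : ℕ} (β : ℝ) (w : L2 n) : Prop :=
  MemH β w ∧ Integrable w volume ∧ ∫ x, w x = 0

/-- `w ∈ C([0,T]; H^β(ℝⁿ))`. -/
def ContinuousInH {n : ℕ} (β T : ℝ) (w : ℝ → L2 n) : Prop :=
  (∀ t ∈ Icc 0 T, MemH β (w t)) ∧ ContinuousOn w (Icc 0 T) ∧
    ∀ t ∈ Icc 0 T, Tendsto (fun s => seminormSq β (w s - w t : L2 n)) (𝓝[Icc 0 T] t) (𝓝 0)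

/-- `w ∈ H¹(0,T; X)` with weak time derivative `w'`. -/
structure IsWeakTimeDeriv {X : Type*} [NormedAddCommGroup X] [NormedSpace ℝ X]
    (T : ℝ) (w w' : ℝ → X) : Prop where
  memLp : MemLp w 2 (volume.restrict (Ioo 0 T))
  memLp_deriv : MemLp w' 2 (volume.restrict (Ioo 0 T))
  integral_eq : ∀ η : ℝ → ℝ, ContDiff ℝ ∞ η → HasCompactSupport η → tsupport η ⊆ Ioo 0 T →
    ∫ t in Ioo 0 T, deriv η t • w t = -∫ t in Ioo 0 T, η t • w' t

/-- `v` is the weak partial derivative of `w` on `ℝⁿ` in the direction of the first coordinate. -/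
def IsWeakDerivFirst {m : ℕ} (w v : L2 (m + 1)) : Prop :=
  ∀ φ : E (m + 1) → ℝ, ContDiff ℝ ∞ φ → HasCompactSupport φ →
    ∫ x, w x * fderiv ℝ φ x (EuclideanSpace.single 0 1) = -∫ x, v x * φ x

/-- For `x = (x₁, x')`, the last coordinates `x'`. -/
def tailCoord {m : ℕ} (x : E (m + 1)) : E m :=
  WithLp.toLp 2 fun i => x i.succ

/-- The cylinder `(0,ℓ) × D'`. -/
def cylinder {m : ℕ} (ℓ : ℝ) (D : Set (E m)) : Set (E (m + 1)) :=
  {x | x 0 ∈ Ioo 0 ℓ ∧ tailCoord x ∈ D}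

/-- `u`, with time derivative `u'` on `Ω`, solves in the variational sense
`∂ₜu + 𝒟(𝒟*u) = f(x',t)` in `Ω × (0,T)`, `𝒩(𝒟*u) = 0` in `Ω_I × (0,T)`, `u(·,0) = 0`,
where `Ω = (0,ℓ) × D'`. The Neumann volume constraint is encoded in the fact that test functions
need not vanish outside `Ω`. -/
structure IsSolution {m : ℕ} (β ℓ T : ℝ) (D : Set (E m)) (f : E m → ℝ → ℝ)
    (u : ℝ → L2 (m + 1)) (u' : ℝ → L2On (cylinder ℓ D)) : Prop where
  initial : u 0 = 0
  variational : ∀ φ : L2 (m + 1), MemHc β φ → ∀ᵐ t ∂(volume.restrict (Ioo 0 T)),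
    IntegrableOn (fun x => f (tailCoord x) t * φ x) (cylinder ℓ D) ∧
    (∫ x in cylinder ℓ D, u' t x * φ x) + energyForm β (u t) φ
      = ∫ x in cylinder ℓ D, f (tailCoord x) t * φ x

end NonlocalDiffusion

end

/-!
Testing the equation with functions supported away from a compact set `K ⊇ Ω` kills both
integrals over `Ω`. When `u(t)` vanishes outside `K`, what remains says that its Riesz potential
`y ↦ ∫ u(x,t) |y - x| ^ (-(n + 2β)) dx` is orthogonal to every such test function of zero mean, so
it is constant on the complement of `K`. Applying derivatives and powers of the Laplacian in `y`
shows that `u(t)` is orthogonal to the kernels `∏ᵢ ⟪eᵢ, y - x⟫ |y - x| ^ (2c)` for suitable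
exponents `c`; up to a common weight these are the polynomials in the inversion of `x` about a fixed
`y`, which are dense by the Stone–Weierstrass theorem. Hence `u = 0`, and the equation, tested with
zero-mean functions that agree with arbitrary polynomials on `K`, gives `F = 0`.
-/

noncomputable section

namespace NonlocalDiffusion

section StoneWeierstrass

/-- The functional `g ↦ ∫ w g dμ` on the continuous functions on a compact space, for an integrable
density `w`. -/
def integralMulCLM {X : Type*} [TopologicalSpace X] [CompactSpace X] [MeasurableSpace X]
    [BorelSpace X] {μ : Measure X} {w : X → ℝ} (hw : Integrable w μ) : C(X, ℝ) →L[ℝ] ℝ :=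
  have hint (g : C(X, ℝ)) : Integrable (fun x => w x * g x) μ :=
    hw.mul_bdd g.continuous.aestronglyMeasurable (ae_of_all _ g.norm_coe_le_norm)
  LinearMap.mkContinuous
    { toFun := fun g => ∫ x, w x * g x ∂μ
      map_add' := fun g₁ g₂ => by
        simp only [ContinuousMap.add_apply, mul_add]
        exact integral_add (hint g₁) (hint g₂)
      map_smul' := fun c g => by
        simp only [ContinuousMap.smul_apply, smul_eq_mul, mul_left_comm _ c, integral_const_mul,
          RingHom.id_apply] }
    (∫ x, ‖w x‖ ∂μ) fun g => by
      rw [← integral_mul_const]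
      refine norm_integral_le_of_norm_le (hw.norm.mul_const _) (ae_of_all _ fun x => ?_)
      rw [norm_mul]
      exact mul_le_mul_of_nonneg_left (g.norm_coe_le_norm x) (norm_nonneg _)

theorem integral_mul_eq_zero_of_separatesPoints {X : Type*} [TopologicalSpace X] [CompactSpace X]
    [MeasurableSpace X] [BorelSpace X] {μ : Measure X} {w : X → ℝ} (hw : Integrable w μ)
    {S : Submonoid C(X, ℝ)} (hS : ((fun g : C(X, ℝ) => (g : X → ℝ)) '' S).SeparatesPoints)
    (h : ∀ g ∈ S, ∫ x, w x * g x ∂μ = 0) (g : C(X, ℝ)) : ∫ x, w x * g x ∂μ = 0 := by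
  set A := Algebra.adjoin ℝ (S : Set C(X, ℝ))
  have hdense : A.topologicalClosure = ⊤ :=
    ContinuousMap.subalgebra_topologicalClosure_eq_top_of_separatesPoints A
      fun x y hxy => (hS hxy).imp fun _ hf => ⟨image_mono Algebra.subset_adjoin hf.1, hf.2⟩
  have hker : (A : Set C(X, ℝ)) ⊆ (integralMulCLM hw).ker := by
    rw [← Subalgebra.coe_toSubmodule, Algebra.adjoin_eq_span, Submonoid.closure_eq]
    exact Submodule.span_le.2 h
  have hmem : g ∈ A.topologicalClosure := hdense ▸ Algebra.mem_top
  exact closure_minimal hker (integralMulCLM hw).isClosed_ker hmem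

theorem ae_eq_zero_of_forall_mem_closure {V : Type*} [NormedAddCommGroup V] [NormedSpace ℝ V]
    [FiniteDimensional ℝ V] [MeasurableSpace V] [BorelSpace V] {μ : Measure V} {K : Set V}
    (hK : IsCompact K) (hμ : ∀ᵐ x ∂μ, x ∈ K) {w : V → ℝ} (hw : Integrable w μ)
    {s : Set (V → ℝ)} (hcont : ∀ g ∈ s, ContinuousOn g K)
    (hsep : ∀ x ∈ K, ∀ y ∈ K, x ≠ y → ∃ g ∈ s, g x ≠ g y)
    (h : ∀ g ∈ Submonoid.closure s, ∫ x, w x * g x ∂μ = 0) : w =ᵐ[μ] 0 := by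
  have : CompactSpace K := isCompact_iff_compactSpace.1 hK
  have htransfer (g : V → ℝ) : ∫ x, g x ∂μ = ∫ x : K, g x ∂μ.comap (↑) := by
    rw [integral_subtype_comap hK.measurableSet, Measure.restrict_eq_self_of_ae_mem hμ]
  have hwK : Integrable (fun x : K => w x) (μ.comap (↑)) :=
    (integrableOn_iff_comap_subtypeVal hK.measurableSet).1 hw.integrableOn
  let S : Submonoid C(K, ℝ) :=
    { carrier := {g | ∃ p ∈ Submonoid.closure s, ∀ x : K, g x = p x}
      one_mem' := ⟨1, one_mem _, fun _ => rfl⟩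
      mul_mem' := fun ⟨p, hp, hgp⟩ ⟨q, hq, hgq⟩ =>
        ⟨p * q, mul_mem hp hq, fun x => congr_arg₂ (· * ·) (hgp x) (hgq x)⟩ }
  have hS : ((fun g : C(K, ℝ) => (g : K → ℝ)) '' S).SeparatesPoints := fun x y hxy => by
    obtain ⟨g, hg, hne⟩ := hsep x x.2 y y.2 (Subtype.coe_ne_coe.2 hxy)
    exact ⟨_, ⟨⟨K.domRestrict g, (hcont g hg).domRestrict⟩,
      ⟨g, Submonoid.subset_closure hg, fun _ => rfl⟩, rfl⟩, hne⟩
  have hS0 : ∀ g ∈ S, ∫ x : K, w x * g x ∂μ.comap (↑) = 0 := fun g ⟨p, hp, hgp⟩ => by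
    simp only [hgp]
    rw [← htransfer (fun x => w x * p x), h p hp]
  refine ae_eq_zero_of_integral_contDiff_smul_eq_zero hw.locallyIntegrable fun g hg _ => ?_
  rw [htransfer]
  simpa [mul_comm] using integral_mul_eq_zero_of_separatesPoints hwK hS hS0
    ⟨K.domRestrict g, hg.continuous.continuousOn.domRestrict⟩

end StoneWeierstrass

section ConvolutionOffSupport

variable {V : Type*} [NormedAddCommGroup V] [NormedSpace ℝ V] [MeasurableSpace V]
  {μ : Measure V} {K : Set V} {w P : V → ℝ}

/-- The kernels `P`, smooth off the origin, whose convolution with the density `w` with respect to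
`μ` vanishes off the set `K`, which is meant to carry `μ`. Integrability is part of the definition,
since `∫` is `0` on functions that are not integrable. -/
def nullKernels (μ : Measure V) (w : V → ℝ) (K : Set V) : Submodule ℝ (V → ℝ) where
  carrier := {P | ContDiffOn ℝ ∞ P {0}ᶜ ∧
    ∀ y ∉ K, Integrable (fun x => w x * P (y - x)) μ ∧ ∫ x, w x * P (y - x) ∂μ = 0}
  zero_mem' := ⟨contDiffOn_const, fun y _ => by simp⟩
  add_mem' := fun hP hQ => ⟨hP.1.add hQ.1, fun y hy => by
    simp only [Pi.add_apply, mul_add]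
    refine ⟨(hP.2 y hy).1.add (hQ.2 y hy).1, ?_⟩
    rw [integral_add (hP.2 y hy).1 (hQ.2 y hy).1, (hP.2 y hy).2, (hQ.2 y hy).2, add_zero]⟩
  smul_mem' := fun c P hP => ⟨contDiffOn_const.smul hP.1, fun y hy => by
    simp only [Pi.smul_apply, smul_eq_mul, mul_left_comm _ c]
    exact ⟨(hP.2 y hy).1.const_mul c, by rw [integral_const_mul, (hP.2 y hy).2, mul_zero]⟩⟩

theorem mem_nullKernels_congr (hμ : ∀ᵐ x ∂μ, x ∈ K) {Q : V → ℝ} (hP : P ∈ nullKernels μ w K)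
    (h : EqOn Q P {0}ᶜ) : Q ∈ nullKernels μ w K := by
  refine ⟨hP.1.congr h, fun y hy => ?_⟩
  have hae : (fun x => w x * Q (y - x)) =ᵐ[μ] fun x => w x * P (y - x) := by
    filter_upwards [hμ] with x hx
    rw [h (sub_ne_zero.2 fun hyx => hy (hyx ▸ hx) : y - x ∈ ({0}ᶜ : Set V))]
  rw [integrable_congr hae, integral_congr_ae hae]
  exact hP.2 y hy

variable [FiniteDimensional ℝ V] [BorelSpace V]

theorem integrable_smul_comp_sub {F : Type*} [NormedAddCommGroup F] [NormedSpace ℝ F]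
    (hK : IsCompact K) (hμ : ∀ᵐ x ∂μ, x ∈ K) (hw : Integrable w μ) {G : V → F}
    (hG : ContinuousOn G {0}ᶜ) {y : V} (hy : y ∉ K) :
    Integrable (fun x => w x • G (y - x)) μ := by
  have hcont : ContinuousOn (fun x => G (y - x)) K :=
    hG.comp (by fun_prop) fun x hx => sub_ne_zero.2 fun h => hy (h ▸ hx)
  rw [← Measure.restrict_eq_self_of_ae_mem hμ]
  exact hw.integrableOn.smul_continuousOn hcont hK

theorem hasFDerivAt_integral_mul_comp_sub (hK : IsCompact K) (hμ : ∀ᵐ x ∂μ, x ∈ K)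
    (hw : Integrable w μ) (hP : ContDiffOn ℝ 1 P {0}ᶜ) {y : V} (hy : y ∉ K) :
    HasFDerivAt (fun y => ∫ x, w x * P (y - x) ∂μ) (∫ x, w x • fderiv ℝ P (y - x) ∂μ) y := by
  have hopen : IsOpen ({0}ᶜ : Set V) := isOpen_compl_singleton
  have hfderiv : ContinuousOn (fderiv ℝ P) {0}ᶜ := hP.continuousOn_fderiv_of_isOpen hopen le_rfl
  obtain ⟨ε, hε, hball⟩ := Metric.nhds_basis_closedBall.mem_iff.1
    (hK.isClosed.isOpen_compl.mem_nhds hy)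
  have hne {z x : V} (hz : z ∈ Metric.closedBall y ε) (hx : x ∈ K) : z - x ∈ ({0}ᶜ : Set V) :=
    sub_ne_zero.2 fun h => hball hz (h ▸ hx)
  obtain ⟨M, hM⟩ := ((isCompact_closedBall y ε).prod hK).exists_bound_of_continuousOn
    (f := fun p : V × V => fderiv ℝ P (p.1 - p.2))
    (hfderiv.comp (by fun_prop) fun p hp => hne hp.1 hp.2)
  refine hasFDerivAt_integral_of_dominated_of_fderiv_le (Metric.closedBall_mem_nhds y hε)
    (F' := fun z x => w x • fderiv ℝ P (z - x)) (bound := fun x => ‖w x‖ * M) ?_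
    (integrable_smul_comp_sub hK hμ hw hP.continuousOn hy)
    (integrable_smul_comp_sub hK hμ hw hfderiv hy).aestronglyMeasurable ?_
    (hw.norm.mul_const M) ?_
  · filter_upwards [hK.isClosed.isOpen_compl.mem_nhds hy] with z hz
    exact (integrable_smul_comp_sub hK hμ hw hP.continuousOn hz).aestronglyMeasurable
  · filter_upwards [hμ] with x hx z hz
    rw [norm_smul]
    gcongr
    exact hM (z, x) ⟨hz, hx⟩
  · filter_upwards [hμ] with x hx z hz
    have hdiff := (hP.differentiableOn one_ne_zero).differentiableAt (hopen.mem_nhds (hne hz hx))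
    exact ((hasFDerivAt_comp_sub x).2 hdiff.hasFDerivAt).const_mul (w x)

theorem fderiv_apply_mem_nullKernels (hK : IsCompact K) (hμ : ∀ᵐ x ∂μ, x ∈ K)
    (hw : Integrable w μ) (hP : ContDiffOn ℝ ∞ P {0}ᶜ) {c : ℝ}
    (hc : ∀ y ∉ K, ∫ x, w x * P (y - x) ∂μ = c) (e : V) :
    (fun z => fderiv ℝ P z e) ∈ nullKernels μ w K := by
  have hfderiv : ContDiffOn ℝ ∞ (fderiv ℝ P) {0}ᶜ :=
    hP.fderiv_of_isOpen isOpen_compl_singleton (by simp)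
  refine ⟨hfderiv.clm_apply contDiffOn_const, fun y hy => ?_⟩
  have hint := integrable_smul_comp_sub hK hμ hw hfderiv.continuousOn hy
  have hconst : HasFDerivAt (fun y => ∫ x, w x * P (y - x) ∂μ) (0 : V →L[ℝ] ℝ) y :=
    (hasFDerivAt_const c y).congr_of_eventuallyEq
      (eventually_of_mem (hK.isClosed.isOpen_compl.mem_nhds hy) hc)
  have hzero : ∫ x, w x • fderiv ℝ P (y - x) ∂μ = 0 :=
    (hasFDerivAt_integral_mul_comp_sub hK hμ hw (hP.of_le (by simp)) hy).unique hconst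
  refine ⟨hint.apply_continuousLinearMap e, ?_⟩
  simpa [hzero] using (ContinuousLinearMap.integral_apply hint e).symm

end ConvolutionOffSupport

section RieszKernels

variable {V : Type*} [NormedAddCommGroup V] [InnerProductSpace ℝ V]

/-- The kernel `∏_{e ∈ m} ⟪e, z⟫ * |z|^{2c}`, a polynomial multiple of a Riesz kernel. These are the
functions reached from `|z|^{2b}` by repeated differentiation. -/
def monomialKernel (m : Multiset V) (c : ℝ) (z : V) : ℝ :=
  (m.map fun e => inner ℝ e z).prod * (‖z‖ ^ 2) ^ c

theorem monomialKernel_zero (c : ℝ) :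
    monomialKernel (0 : Multiset V) c = fun z => (‖z‖ ^ 2) ^ c := by
  ext z
  simp [monomialKernel]

theorem contDiffOn_monomialKernel (m : Multiset V) (c : ℝ) :
    ContDiffOn ℝ ∞ (monomialKernel m c) {0}ᶜ := by
  refine ContDiffOn.mul (ContDiff.contDiffOn ?_) fun z hz => ?_
  · induction m using Multiset.induction with
    | empty => simpa using contDiff_const
    | cons e m ih => simpa using (contDiff_const.inner ℝ contDiff_id).mul ih
  · exact ((contDiff_norm_sq ℝ).contDiffAt.rpow_const_of_ne
      (pow_ne_zero 2 (norm_ne_zero_iff.2 hz))).contDiffWithinAt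

theorem fderiv_monomialKernel_apply [DecidableEq V] (m : Multiset V) (c : ℝ) {z : V} (hz : z ≠ 0)
    (e : V) : fderiv ℝ (monomialKernel m c) z e =
      (m.map fun j => inner ℝ j e * monomialKernel (m.erase j) c z).sum +
        2 * c * monomialKernel (e ::ₘ m) (c - 1) z := by
  have hprod := HasFDerivAt.multiset_prod (u := m) (x := z) (g := fun j z => inner ℝ j z)
    fun j _ => (innerSL ℝ j).hasFDerivAt
  have hpow := ((hasFDerivAt_id z).norm_sq).rpow_const (p := c)
    (Or.inl (pow_ne_zero 2 (norm_ne_zero_iff.2 hz)))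
  have happly : (m.map fun j =>
      ((m.erase j).map fun i => inner ℝ i z).prod • innerSL ℝ j).sum e =
      (m.map fun j => ((m.erase j).map fun i => inner ℝ i z).prod * inner ℝ j e).sum := by
    simpa [Function.comp_def] using map_multiset_sum (ContinuousLinearMap.apply ℝ ℝ e)
      (m.map fun j => ((m.erase j).map fun i => inner ℝ i z).prod • innerSL ℝ j)
  have hfderiv : fderiv ℝ (monomialKernel m c) z = _ := (hprod.mul hpow).fderiv
  simp only [hfderiv, add_apply, smul_apply, happly, smul_eq_mul]
  rw [← Multiset.sum_map_mul_left, add_comm]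
  congr 1
  · refine congr_arg Multiset.sum (Multiset.map_congr rfl fun j _ => ?_)
    rw [monomialKernel, id]
    ring
  · simp only [id_eq, ContinuousLinearMap.comp_id, coe_innerSL_apply, nsmul_eq_mul, Nat.cast_ofNat,
      monomialKernel, Multiset.map_cons, real_inner_comm z e, Multiset.prod_cons]
    ring

theorem sum_fderiv_monomialKernel_singleton {ι : Type*} [Fintype ι] (o : OrthonormalBasis ι ℝ V)
    (c : ℝ) {z : V} (hz : z ≠ 0) :
    ∑ i, fderiv ℝ (monomialKernel {o i} c) z (o i) =
      (Fintype.card ι + 2 * c) * monomialKernel 0 c z := by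
  classical
  have hterm (i : ι) : fderiv ℝ (monomialKernel {o i} c) z (o i) =
      (‖z‖ ^ 2) ^ c + 2 * c * (‖z‖ ^ 2) ^ (c - 1) * inner ℝ (o i) z ^ 2 := by
    rw [fderiv_monomialKernel_apply _ _ hz]
    simp only [monomialKernel, Multiset.map_singleton, inner_self_eq_norm_sq_to_K,
      OrthonormalBasis.norm_eq_one, Real.ringHom_apply, one_pow, Multiset.erase_singleton,
      Multiset.map_zero, Multiset.prod_zero, one_mul, Multiset.sum_singleton, Multiset.map_cons,
      Multiset.prod_cons, Multiset.prod_singleton, add_right_inj]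
    ring
  have hpow : (‖z‖ ^ 2) ^ c = (‖z‖ ^ 2) ^ (c - 1) * ‖z‖ ^ 2 := by
    rw [← Real.rpow_add_one (pow_ne_zero 2 (norm_ne_zero_iff.2 hz)), sub_add_cancel]
  simp only [hterm, Finset.sum_add_distrib, ← Finset.mul_sum, o.sum_sq_inner_right,
    Finset.sum_const, Finset.card_univ, nsmul_eq_mul, monomialKernel_zero]
  rw [add_mul, mul_assoc _ _ (‖z‖ ^ 2), ← hpow]

variable [MeasurableSpace V] {μ : Measure V} {K : Set V} {w : V → ℝ}

theorem monomialKernel_cons_mem_nullKernels [DecidableEq V] (hμ : ∀ᵐ x ∂μ, x ∈ K)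
    {m : Multiset V} {c : ℝ} (hc : c ≠ 0) {e : V}
    (hderiv : (fun z => fderiv ℝ (monomialKernel m c) z e) ∈ nullKernels μ w K)
    (herase : ∀ j ∈ m, monomialKernel (m.erase j) c ∈ nullKernels μ w K) :
    monomialKernel (e ::ₘ m) (c - 1) ∈ nullKernels μ w K := by
  have hsum : (m.map fun j => inner ℝ j e • monomialKernel (m.erase j) c).sum ∈
      nullKernels μ w K :=
    multiset_sum_mem _ fun P hP => by
      obtain ⟨j, hj, rfl⟩ := Multiset.mem_map.1 hP
      exact Submodule.smul_mem _ _ (herase j hj)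
  refine mem_nullKernels_congr hμ
    (Submodule.smul_mem _ (2 * c)⁻¹ (Submodule.sub_mem _ hderiv hsum)) fun z hz => ?_
  simp only [Pi.smul_apply, Pi.sub_apply, fderiv_monomialKernel_apply m c hz e, smul_eq_mul]
  have happly : (m.map fun j => inner ℝ j e • monomialKernel (m.erase j) c).sum z =
      (m.map fun j => inner ℝ j e * monomialKernel (m.erase j) c z).sum := by
    simpa [Function.comp_def] using map_multiset_sum (Pi.evalAddMonoidHom (fun _ : V => ℝ) z)
      (m.map fun j => inner ℝ j e • monomialKernel (m.erase j) c)
  rw [happly, add_sub_cancel_left, inv_mul_cancel_left₀ (mul_ne_zero two_ne_zero hc)]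

variable [FiniteDimensional ℝ V] [BorelSpace V]

theorem monomialKernel_zero_mem_nullKernels_of_singleton (hK : IsCompact K) (hμ : ∀ᵐ x ∂μ, x ∈ K)
    (hw : Integrable w μ) {c : ℝ} (hc : (Module.finrank ℝ V : ℝ) + 2 * c ≠ 0)
    (h : ∀ e : V, monomialKernel {e} c ∈ nullKernels μ w K) :
    monomialKernel 0 c ∈ nullKernels μ w K := by
  classical
  let o := stdOrthonormalBasis ℝ V
  have hsum : (∑ i, fun z => fderiv ℝ (monomialKernel {o i} c) z (o i)) ∈ nullKernels μ w K :=
    Submodule.sum_mem _ fun i _ => fderiv_apply_mem_nullKernels hK hμ hw (h (o i)).1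
      (fun y hy => ((h (o i)).2 y hy).2) (o i)
  refine mem_nullKernels_congr hμ (Submodule.smul_mem _ (Module.finrank ℝ V + 2 * c)⁻¹ hsum)
    fun z hz => ?_
  rw [Pi.smul_apply, Finset.sum_apply, sum_fderiv_monomialKernel_singleton o c hz,
    Fintype.card_fin, smul_eq_mul, inv_mul_cancel_left₀ hc]

theorem monomialKernel_zero_sub_one_mem_nullKernels (hK : IsCompact K) (hμ : ∀ᵐ x ∂μ, x ∈ K)
    (hw : Integrable w μ) {b a : ℝ} (hb : b < 0) (hb' : (Module.finrank ℝ V : ℝ) + 2 * b < 2)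
    (h : ∀ y ∉ K, ∫ x, w x * monomialKernel 0 b (y - x) ∂μ = a) :
    monomialKernel 0 (b - 1) ∈ nullKernels μ w K := by
  classical
  exact monomialKernel_zero_mem_nullKernels_of_singleton hK hμ hw (by linarith) fun e =>
    monomialKernel_cons_mem_nullKernels hμ hb.ne
      (fderiv_apply_mem_nullKernels hK hμ hw (contDiffOn_monomialKernel 0 b) h e) (by simp)

theorem monomialKernel_mem_nullKernels (hK : IsCompact K) (hμ : ∀ᵐ x ∂μ, x ∈ K)
    (hw : Integrable w μ) {b a : ℝ} (hb : b < 0) (hb' : (Module.finrank ℝ V : ℝ) + 2 * b < 2)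
    (h : ∀ y ∉ K, ∫ x, w x * monomialKernel 0 b (y - x) ∂μ = a) (m : Multiset V) {k : ℕ}
    (hk : m.card ≤ k) : monomialKernel m (b - 1 - k) ∈ nullKernels μ w K := by
  classical
  induction k generalizing m with
  | zero =>
    obtain rfl := Multiset.card_eq_zero.1 (Nat.le_zero.1 hk)
    simpa using monomialKernel_zero_sub_one_mem_nullKernels hK hμ hw hb hb' h
  | succ k ih =>
    have hcast : b - 1 - (k + 1 : ℕ) = b - 1 - k - 1 := by push_cast; ring
    have hneg : b - 1 - k < 0 := by linarith [k.cast_nonneg (α := ℝ)]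
    have hzero := ih 0 (by simp)
    rw [hcast]
    induction m using Multiset.induction with
    | empty =>
      exact monomialKernel_zero_sub_one_mem_nullKernels hK hμ hw hneg
        (by linarith [k.cast_nonneg (α := ℝ)]) fun y hy => (hzero.2 y hy).2
    | cons e m =>
      rw [Multiset.card_cons, Nat.succ_le_succ_iff] at hk
      have hm := ih m hk
      exact monomialKernel_cons_mem_nullKernels hμ hneg.ne
        (fderiv_apply_mem_nullKernels hK hμ hw hm.1 (fun y hy => (hm.2 y hy).2) e)
        fun j _ => ih _ (Multiset.card_erase_le.trans hk)

end RieszKernels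

section UniqueContinuation

/-- The potential `∫ w(x) |y - x|^{2b} dμ(x)` of the density `w` with respect to `μ`. The kernel is
written as a power of `|y - x|²` because the square of the norm is smooth. -/
def rieszPotential {V : Type*} [NormedAddCommGroup V] [MeasurableSpace V] (μ : Measure V) (b : ℝ)
    (w : V → ℝ) (y : V) : ℝ :=
  ∫ x, w x * (‖y - x‖ ^ 2) ^ b ∂μ

variable {V : Type*} [NormedAddCommGroup V] [InnerProductSpace ℝ V]

theorem continuousOn_rieszPotential [FiniteDimensional ℝ V] [MeasurableSpace V] [BorelSpace V]
    {μ : Measure V} {K : Set V} (hK : IsCompact K) (hμ : ∀ᵐ x ∂μ, x ∈ K) {w : V → ℝ}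
    (hw : Integrable w μ) (b : ℝ) : ContinuousOn (rieszPotential μ b w) Kᶜ := fun y hy => by
  have hderiv := hasFDerivAt_integral_mul_comp_sub hK hμ hw
    ((contDiffOn_monomialKernel 0 b).of_le (by simp)) hy
  rw [monomialKernel_zero] at hderiv
  exact hderiv.continuousAt.continuousWithinAt

theorem injective_inv_norm_sq_smul : Function.Injective fun z : V => (‖z‖ ^ 2)⁻¹ • z := by
  convert EuclideanGeometry.inversion_injective (0 : V) one_ne_zero using 2 with z
  simp [EuclideanGeometry.inversion]

theorem exists_inner_inv_norm_sq_smul_ne {y x x' : V} (h : x ≠ x') :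
    ∃ e : V, inner ℝ e (y - x) * (‖y - x‖ ^ 2)⁻¹ ≠ inner ℝ e (y - x') * (‖y - x'‖ ^ 2)⁻¹ := by
  by_contra! hall
  refine h (sub_right_injective (b := y) (injective_inv_norm_sq_smul ?_))
  refine ext_inner_left ℝ fun e => ?_
  simpa only [inner_smul_right, mul_comm] using hall e

theorem exists_eq_monomialKernel {y : V} {g : V → ℝ}
    (hg : g ∈ Submonoid.closure (range fun e x => inner ℝ e (y - x) * (‖y - x‖ ^ 2)⁻¹)) :
    ∃ m : Multiset V, ∀ x, g x = monomialKernel m (-m.card) (y - x) := by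
  have hrpow (m : Multiset V) (z : V) : monomialKernel m (-m.card) z =
      (m.map fun e => inner ℝ e z).prod * ((‖z‖ ^ 2) ^ m.card)⁻¹ := by
    rw [monomialKernel, Real.rpow_neg (sq_nonneg _), Real.rpow_natCast]
  simp only [hrpow]
  induction hg using Submonoid.closure_induction with
  | mem g hg =>
    obtain ⟨e, rfl⟩ := hg
    exact ⟨{e}, by simp⟩
  | one => exact ⟨0, by simp⟩
  | mul f g _ _ hf hg =>
    obtain ⟨m, hm⟩ := hf
    obtain ⟨m', hm'⟩ := hg
    refine ⟨m + m', fun x => ?_⟩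
    rw [Pi.mul_apply, hm, hm', Multiset.map_add, Multiset.prod_add, Multiset.card_add, pow_add,
      mul_inv, mul_mul_mul_comm]

theorem ae_eq_zero_of_rieszPotential_const [FiniteDimensional ℝ V] [Nontrivial V]
    [MeasurableSpace V] [BorelSpace V] {μ : Measure V} {K : Set V} (hK : IsCompact K)
    (hμ : ∀ᵐ x ∂μ, x ∈ K) {w : V → ℝ} (hw : Integrable w μ) {b a : ℝ} (hb : b < 0)
    (hb' : (Module.finrank ℝ V : ℝ) + 2 * b < 2)
    (h : ∀ y ∉ K, rieszPotential μ b w y = a) : w =ᵐ[μ] 0 := by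
  have := NormedSpace.noncompactSpace ℝ V
  obtain ⟨y, hy⟩ := (ne_univ_iff_exists_notMem K).1 hK.ne_univ
  have hpos (x) (hx : x ∈ K) : 0 < ‖y - x‖ ^ 2 :=
    pow_pos (norm_pos_iff.2 (sub_ne_zero.2 (ne_of_mem_of_not_mem hx hy).symm)) 2
  have hkernel (m : Multiset V) : monomialKernel m (b - 1 - m.card) ∈ nullKernels μ w K :=
    monomialKernel_mem_nullKernels hK hμ hw hb hb' (by rwa [monomialKernel_zero]) m le_rfl
  have hweight : (fun x => w x * (‖y - x‖ ^ 2) ^ (b - 1)) =ᵐ[μ] 0 := by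
    have hint := ((hkernel 0).2 y hy).1
    simp only [monomialKernel_zero, Multiset.card_zero, Nat.cast_zero, sub_zero] at hint
    refine ae_eq_zero_of_forall_mem_closure hK hμ hint
      (s := range fun e x => inner ℝ e (y - x) * (‖y - x‖ ^ 2)⁻¹) ?_ ?_ fun g hg => ?_
    · rintro _ ⟨e, rfl⟩
      exact (by fun_prop : Continuous fun x => inner ℝ e (y - x)).continuousOn.mul
        ((by fun_prop : Continuous fun x => ‖y - x‖ ^ 2).continuousOn.inv₀ fun x hx =>
          (hpos x hx).ne')
    · intro x _ x' _ hxx'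
      obtain ⟨e, he⟩ := exists_inner_inv_norm_sq_smul_ne (y := y) hxx'
      exact ⟨_, ⟨e, rfl⟩, he⟩
    · obtain ⟨m, hm⟩ := exists_eq_monomialKernel hg
      rw [← ((hkernel m).2 y hy).2]
      refine integral_congr_ae ?_
      filter_upwards [hμ] with x hx
      rw [hm, mul_assoc, sub_eq_add_neg (b - 1), monomialKernel, monomialKernel,
        Real.rpow_add (hpos x hx)]
      ring
  filter_upwards [hμ, hweight] with x hx hwx
  exact (mul_eq_zero.1 hwx).resolve_right (Real.rpow_pos_of_pos (hpos x hx) _).ne'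

end UniqueContinuation

section TestFunctions

variable {V : Type*} [NormedAddCommGroup V] [MeasurableSpace V] [BorelSpace V] {μ : Measure V}

theorem integrable_mul_of_tsupport_subset [IsFiniteMeasureOnCompacts μ] {U : Set V}
    {φ G : V → ℝ} (hφ : Continuous φ) (hc : HasCompactSupport φ) (hφU : tsupport φ ⊆ U)
    (hG : ContinuousOn G U) : Integrable (fun x => φ x * G x) μ := by
  have hsub : Function.support (fun x => φ x * G x) ⊆ tsupport φ :=
    (Function.support_mul_subset_left φ G).trans (subset_tsupport φ)
  rw [← integrableOn_iff_integrable_of_support_subset hsub]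
  exact (hφ.continuousOn.mul (hG.mono hφU)).integrableOn_compact hc

variable [NormedSpace ℝ V] [FiniteDimensional ℝ V] [μ.IsAddHaarMeasure]

theorem exists_contDiff_integral_eq_one {U : Set V} (hU : IsOpen U) (hne : U.Nonempty) :
    ∃ ψ : V → ℝ, ContDiff ℝ ∞ ψ ∧ HasCompactSupport ψ ∧ tsupport ψ ⊆ U ∧ ∫ x, ψ x ∂μ = 1 := by
  obtain ⟨c, hc⟩ := hne
  obtain ⟨ε, hε, hball⟩ := Metric.nhds_basis_closedBall.mem_iff.1 (hU.mem_nhds hc)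
  let g : ContDiffBump c := ⟨ε / 2, ε, half_pos hε, half_lt_self hε⟩
  exact ⟨g.normed μ, g.contDiff_normed, g.hasCompactSupport_normed,
    g.tsupport_normed_eq.trans_subset hball, g.integral_normed⟩

theorem exists_forall_eq_of_integral_mul_eq_zero {U : Set V} (hU : IsOpen U)
    {G : V → ℝ} (hG : ContinuousOn G U)
    (h : ∀ φ : V → ℝ, ContDiff ℝ ∞ φ → HasCompactSupport φ → tsupport φ ⊆ U →
      ∫ x, φ x ∂μ = 0 → ∫ x, φ x * G x ∂μ = 0) : ∃ c, ∀ y ∈ U, G y = c := by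
  rcases U.eq_empty_or_nonempty with rfl | hne
  · exact ⟨0, by simp⟩
  obtain ⟨ψ, hψ, hψc, hψU, hψ1⟩ := exists_contDiff_integral_eq_one (μ := μ) hU hne
  set c := ∫ x, ψ x * G x ∂μ
  have hψi : Integrable ψ μ := hψ.continuous.integrable_of_hasCompactSupport hψc
  have hψG := integrable_mul_of_tsupport_subset (μ := μ) hψ.continuous hψc hψU hG
  have hae : ∀ᵐ x ∂μ, x ∈ U → G x - c = 0 := by
    refine hU.ae_eq_zero_of_integral_contDiff_smul_eq_zero
      ((hG.sub continuousOn_const).locallyIntegrableOn hU.measurableSet) fun φ hφ hφc hφU => ?_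
    have hφi : Integrable φ μ := hφ.continuous.integrable_of_hasCompactSupport hφc
    have hφG := integrable_mul_of_tsupport_subset (μ := μ) hφ.continuous hφc hφU hG
    have hzero := h (fun x => φ x - (∫ x, φ x ∂μ) * ψ x) (hφ.sub (contDiff_const.mul hψ))
      (hφc.sub (hψc.mul_left (f := fun _ => ∫ x, φ x ∂μ)))
      ((tsupport_sub _ _).trans (union_subset hφU (tsupport_mul_subset_right.trans hψU)))
      (by rw [integral_sub hφi (hψi.const_mul _), integral_const_mul, hψ1, mul_one, sub_self])
    simp only [sub_mul, mul_assoc] at hzero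
    rw [integral_sub hφG (hψG.const_mul _), integral_const_mul] at hzero
    simp only [smul_eq_mul, mul_sub]
    rwa [integral_sub hφG (hφi.mul_const c), integral_mul_const]
  refine ⟨c, fun y hy => Measure.eqOn_open_of_ae_eq (μ := μ) (g := fun _ => c) ?_ hU hG
    continuousOn_const hy⟩
  rw [EventuallyEq, ae_restrict_iff' hU.measurableSet]
  filter_upwards [hae] with x hx hxU
  exact sub_eq_zero.1 (hx hxU)

theorem exists_contDiff_integral_eq_zero_eqOn [Nontrivial V] {K : Set V} (hK : IsCompact K)
    {g : V → ℝ} (hg : ContDiff ℝ ∞ g) :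
    ∃ φ : V → ℝ, ContDiff ℝ ∞ φ ∧ HasCompactSupport φ ∧ ∫ x, φ x ∂μ = 0 ∧ EqOn φ g K := by
  have := NormedSpace.noncompactSpace ℝ V
  obtain ⟨ψ, hψ, hψc, hψK, hψ1⟩ := exists_contDiff_integral_eq_one (μ := μ)
    hK.isClosed.isOpen_compl (nonempty_compl.2 hK.ne_univ)
  obtain ⟨R, hR, hKR⟩ := hK.isBounded.subset_closedBall_lt 0 0
  let χ : ContDiffBump (0 : V) := ⟨R, R + 1, hR, lt_add_one R⟩
  have hχg : ContDiff ℝ ∞ fun x => χ x * g x := χ.contDiff.mul hg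
  have hχgc : HasCompactSupport fun x => χ x * g x := χ.hasCompactSupport.mul_right
  refine ⟨fun x => χ x * g x - (∫ x, χ x * g x ∂μ) * ψ x, hχg.sub (contDiff_const.mul hψ),
    hχgc.sub (hψc.mul_left (f := fun _ => ∫ x, χ x * g x ∂μ)), ?_, fun x hx => ?_⟩
  · rw [integral_sub (hχg.continuous.integrable_of_hasCompactSupport hχgc)
      ((hψ.continuous.integrable_of_hasCompactSupport hψc).const_mul _), integral_const_mul, hψ1,
      mul_one, sub_self]
  · simp only [χ.one_of_mem_closedBall (hKR hx), one_mul,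
      image_eq_zero_of_notMem_tsupport fun hψx => hψK hψx hx, mul_zero, sub_zero]

end TestFunctions

section FractionalSobolev

theorem integrableOn_min_sq_mul_rpow {β : ℝ} (hβ₀ : 0 < β) (hβ₁ : β < 1) {A B : ℝ} (hA : 0 ≤ A)
    (hB : 0 ≤ B) : IntegrableOn (fun r => min (A * r ^ 2) B * r ^ (-1 - 2 * β)) (Ioi 0) := by
  have hmeas : Measurable fun r : ℝ => min (A * r ^ 2) B * r ^ (-1 - 2 * β) := by fun_prop
  have hnorm {r : ℝ} (hr : 0 < r) : ‖min (A * r ^ 2) B * r ^ (-1 - 2 * β)‖ =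
      min (A * r ^ 2) B * r ^ (-1 - 2 * β) :=
    Real.norm_of_nonneg (mul_nonneg (le_min (by positivity) hB) (Real.rpow_nonneg hr.le _))
  rw [← Ioc_union_Ioi_eq_Ioi zero_le_one]
  refine IntegrableOn.union ?_ ?_
  · have hint : IntegrableOn (fun r : ℝ => A * r ^ (1 - 2 * β)) (Ioc 0 1) := by
      rw [← intervalIntegrable_iff_integrableOn_Ioc_of_le zero_le_one]
      exact (intervalIntegral.intervalIntegrable_rpow' (by linarith)).const_mul A
    refine Integrable.mono' hint hmeas.aestronglyMeasurable ?_
    filter_upwards [ae_restrict_mem measurableSet_Ioc] with r hr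
    have hpow : r ^ (1 - 2 * β) = r ^ 2 * r ^ (-1 - 2 * β) := by
      rw [← Real.rpow_two, ← Real.rpow_add hr.1]
      ring_nf
    rw [hnorm hr.1, hpow, ← mul_assoc]
    exact mul_le_mul_of_nonneg_right (min_le_left _ _) (Real.rpow_nonneg hr.1.le _)
  · have hint : IntegrableOn (fun r : ℝ => B * r ^ (-1 - 2 * β)) (Ioi 1) :=
      (integrableOn_Ioi_rpow_of_lt (by linarith) one_pos).const_mul B
    refine Integrable.mono' hint hmeas.aestronglyMeasurable ?_
    filter_upwards [ae_restrict_mem measurableSet_Ioi] with r hr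
    have hr₀ : 0 < r := one_pos.trans hr
    rw [hnorm hr₀]
    exact mul_le_mul_of_nonneg_right (min_le_right _ _) (Real.rpow_nonneg hr₀.le _)

theorem integrable_min_sq_div_rpow {V : Type*} [NormedAddCommGroup V] [NormedSpace ℝ V]
    [FiniteDimensional ℝ V] [Nontrivial V] [MeasurableSpace V] [BorelSpace V] {μ : Measure V}
    [μ.IsAddHaarMeasure] {β : ℝ} (hβ₀ : 0 < β) (hβ₁ : β < 1) {A B : ℝ} (hA : 0 ≤ A)
    (hB : 0 ≤ B) :
    Integrable (fun z => min (A * ‖z‖ ^ 2) B / ‖z‖ ^ (Module.finrank ℝ V + 2 * β)) μ := by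
  refine (integrable_fun_norm_addHaar (E := V) μ
    (f := fun r => min (A * r ^ 2) B / r ^ (Module.finrank ℝ V + 2 * β))).2 ?_
  refine (integrableOn_min_sq_mul_rpow hβ₀ hβ₁ hA hB).congr_fun (fun r hr => ?_) measurableSet_Ioi
  have hr₀ : 0 < r := hr
  have hpow : r ^ (-1 - 2 * β) =
      r ^ (Module.finrank ℝ V - 1) * (r ^ (Module.finrank ℝ V + 2 * β))⁻¹ := by
    rw [← Real.rpow_natCast, Nat.cast_pred Module.finrank_pos, ← Real.rpow_neg hr₀.le,
      ← Real.rpow_add hr₀]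
    ring_nf
  simp only [hpow, smul_eq_mul]
  ring

theorem lintegral_indicator_add_indicator_mul_sub {G : Type*} [AddCommGroup G]
    [MeasurableSpace G] [MeasurableAdd₂ G] [MeasurableNeg G] {μ : Measure G} [SFinite μ]
    [μ.IsAddLeftInvariant] [μ.IsNegInvariant] {S : Set G} (hS : MeasurableSet S) {g : G → ℝ≥0∞}
    (hg : Measurable g) :
    ∫⁻ x, ∫⁻ y, (S.indicator 1 x * g (y - x) + S.indicator 1 y * g (y - x)) ∂μ ∂μ =
      2 * (μ S * ∫⁻ z, g z ∂μ) := by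
  have hind : Measurable (S.indicator (1 : G → ℝ≥0∞)) := measurable_one.indicator hS
  have hleft : ∫⁻ x, ∫⁻ y, S.indicator 1 x * g (y - x) ∂μ ∂μ = μ S * ∫⁻ z, g z ∂μ := by
    rw [← lintegral_indicator_one hS, ← lintegral_mul_const _ hind]
    refine lintegral_congr fun x => ?_
    rw [lintegral_const_mul _ (by fun_prop), lintegral_sub_right_eq_self g x]
  have hright : ∫⁻ x, ∫⁻ y, S.indicator 1 y * g (y - x) ∂μ ∂μ = μ S * ∫⁻ z, g z ∂μ := by
    rw [lintegral_lintegral_swap (by fun_prop), ← lintegral_indicator_one hS,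
      ← lintegral_mul_const _ hind]
    refine lintegral_congr fun y => ?_
    rw [lintegral_const_mul _ (by fun_prop), lintegral_sub_left_eq_self g y]
  have hadd (x : G) : ∫⁻ y, (S.indicator 1 x * g (y - x) + S.indicator 1 y * g (y - x)) ∂μ =
      ∫⁻ y, S.indicator 1 x * g (y - x) ∂μ + ∫⁻ y, S.indicator 1 y * g (y - x) ∂μ :=
    lintegral_add_left (by fun_prop) _
  have hmeas : Measurable fun x => ∫⁻ y, S.indicator 1 x * g (y - x) ∂μ :=
    Measurable.lintegral_prod_right'
      (f := fun p : G × G => S.indicator 1 p.1 * g (p.2 - p.1)) (by fun_prop)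
  simp only [hadd]
  rw [lintegral_add_left hmeas, hleft, hright, two_mul]

theorem sq_sub_le_min_of_lipschitzWith {X : Type*} [PseudoMetricSpace X] {φ : X → ℝ}
    {L : NNReal} (hL : LipschitzWith L φ) {M : ℝ} (hM : ∀ x, ‖φ x‖ ≤ M) (x y : X) :
    (φ y - φ x) ^ 2 ≤ min (L ^ 2 * dist y x ^ 2) ((2 * M) ^ 2) := by
  have hlip : |φ y - φ x| ≤ L * dist y x := hL.dist_le_mul y x
  have hbound : |φ y - φ x| ≤ 2 * M := by
    linarith [norm_sub_le (φ y) (φ x), hM x, hM y, Real.norm_eq_abs (φ y - φ x)]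
  rw [← sq_abs, ← mul_pow]
  exact le_min (by gcongr) (by gcongr)

variable {n : ℕ} {β : ℝ} {w w₁ φ : E n → ℝ}

theorem seminormSq_congr (h : w =ᵐ[volume] w₁) : seminormSq β w = seminormSq β w₁ := by
  refine lintegral_congr_ae ?_
  filter_upwards [h] with x hx
  refine lintegral_congr_ae ?_
  filter_upwards [h] with y hy
  rw [hx, hy]

theorem seminormSq_lt_top_of_lipschitzWith [NeZero n] (hβ₀ : 0 < β) (hβ₁ : β < 1) {L : NNReal}
    (hL : LipschitzWith L φ) (hc : HasCompactSupport φ) : seminormSq β φ < ⊤ := by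
  obtain ⟨M, hM⟩ := hL.continuous.bounded_above_of_compact_support hc
  set g : E n → ℝ≥0∞ := fun z =>
    ENNReal.ofReal (min (L ^ 2 * ‖z‖ ^ 2) ((2 * M) ^ 2) / ‖z‖ ^ ((n : ℝ) + 2 * β))
  have hg_meas : Measurable g := by fun_prop
  have hg_fin : ∫⁻ z, g z < ⊤ := by
    simpa using (integrable_min_sq_div_rpow (V := E n) (μ := volume) hβ₀ hβ₁ (sq_nonneg (L : ℝ))
      (sq_nonneg (2 * M))).lintegral_lt_top
  have hle (x y : E n) :
      ENNReal.ofReal ((φ y - φ x) ^ 2 / ‖y - x‖ ^ ((n : ℝ) + 2 * β)) ≤ g (y - x) := by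
    have hsq := sq_sub_le_min_of_lipschitzWith hL hM x y
    rw [dist_eq_norm] at hsq
    exact ENNReal.ofReal_le_ofReal (by gcongr)
  have hindicator (x y : E n) :
      ENNReal.ofReal ((φ y - φ x) ^ 2 / ‖y - x‖ ^ ((n : ℝ) + 2 * β)) ≤
        (tsupport φ).indicator 1 x * g (y - x) + (tsupport φ).indicator 1 y * g (y - x) := by
    by_cases hx : x ∈ tsupport φ
    · simpa [hx] using (hle x y).trans le_self_add
    by_cases hy : y ∈ tsupport φ
    · simpa [hy] using (hle x y).trans le_add_self
    simp [image_eq_zero_of_notMem_tsupport hx, image_eq_zero_of_notMem_tsupport hy]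
  calc seminormSq β φ
      ≤ ∫⁻ x, ∫⁻ y, ((tsupport φ).indicator 1 x * g (y - x) +
          (tsupport φ).indicator 1 y * g (y - x)) :=
        lintegral_mono fun x => lintegral_mono fun y => hindicator x y
    _ = 2 * (volume (tsupport φ) * ∫⁻ z, g z) :=
        lintegral_indicator_add_indicator_mul_sub (isClosed_tsupport φ).measurableSet hg_meas
    _ < ⊤ := ENNReal.mul_lt_top ENNReal.ofNat_lt_top (ENNReal.mul_lt_top hc.measure_lt_top hg_fin)

theorem memHc_toLp [NeZero n] (hβ₀ : 0 < β) (hβ₁ : β < 1) (hφ : ContDiff ℝ ∞ φ)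
    (hc : HasCompactSupport φ) (h0 : ∫ x, φ x = 0) :
    MemHc β ((hφ.continuous.memLp_of_hasCompactSupport hc : MemLp φ 2 volume).toLp φ) := by
  have hae := (hφ.continuous.memLp_of_hasCompactSupport hc : MemLp φ 2 volume).coeFn_toLp
  obtain ⟨L, hL⟩ := ContDiff.lipschitzWith_of_hasCompactSupport hc hφ (by simp)
  refine ⟨?_, ?_, ?_⟩
  · rw [MemH, seminormSq_congr hae]
    exact seminormSq_lt_top_of_lipschitzWith hβ₀ hβ₁ hL hc
  · rw [integrable_congr hae]
    exact hφ.continuous.integrable_of_hasCompactSupport hc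
  · rw [integral_congr_ae hae, h0]

end FractionalSobolev

section Energy

theorem integrable_mul_mul_rpow_norm_sub {V : Type*} [NormedAddCommGroup V] [NormedSpace ℝ V]
    [FiniteDimensional ℝ V] [MeasurableSpace V] [BorelSpace V] {μ ν : Measure V} [SFinite μ]
    [SFinite ν] {K S : Set V} (hK : IsCompact K) (hS : IsClosed S) (hKS : Disjoint K S)
    {w φ : V → ℝ} (hw : Integrable w μ) (hφ : Integrable φ ν) (hwK : ∀ x ∉ K, w x = 0)
    (hφS : ∀ y ∉ S, φ y = 0) {b : ℝ} (hb : b ≤ 0) :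
    Integrable (fun p : V × V => w p.1 * φ p.2 * (‖p.2 - p.1‖ ^ 2) ^ b) (μ.prod ν) := by
  obtain ⟨r, hr, hdist⟩ := Metric.exists_pos_forall_lt_edist hK hS hKS
  have hkernel : Measurable fun p : V × V => (‖p.2 - p.1‖ ^ 2) ^ b := by fun_prop
  refine ((hw.mul_prod hφ).mul_const (((r : ℝ) ^ 2) ^ b)).mono
    ((hw.mul_prod hφ).aestronglyMeasurable.mul hkernel.aestronglyMeasurable)
    (ae_of_all _ fun p => ?_)
  by_cases hx : p.1 ∈ K
  swap
  · simp [hwK _ hx]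
  by_cases hy : p.2 ∈ S
  swap
  · simp [hφS _ hy]
  have hlt : (r : ℝ) < ‖p.2 - p.1‖ := by
    have hedist := hdist _ hx _ hy
    rw [edist_nndist, ENNReal.coe_lt_coe] at hedist
    rwa [← dist_eq_norm, dist_comm, ← coe_nndist, NNReal.coe_lt_coe]
  rw [norm_mul, norm_mul _ (((r : ℝ) ^ 2) ^ b),
    Real.norm_of_nonneg (Real.rpow_nonneg (sq_nonneg ‖p.2 - p.1‖) b),
    Real.norm_of_nonneg (Real.rpow_nonneg (sq_nonneg (r : ℝ)) b)]
  exact mul_le_mul_of_nonneg_left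
    (Real.rpow_le_rpow_of_nonpos (pow_pos (NNReal.coe_pos.2 hr) 2) (by gcongr) hb) (norm_nonneg _)

variable {n : ℕ} {β : ℝ} {w w₁ φ φ₁ : E n → ℝ} {K S : Set (E n)}

theorem energyForm_congr (hw : w =ᵐ[volume] w₁) (hφ : φ =ᵐ[volume] φ₁) :
    energyForm β w φ = energyForm β w₁ φ₁ := by
  refine integral_congr_ae ?_
  filter_upwards [hw, hφ] with x hwx hφx
  refine integral_congr_ae ?_
  filter_upwards [hw, hφ] with y hwy hφy
  simp only [Dstar, hwx, hφx, hwy, hφy]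

theorem energyForm_comm (w φ : E n → ℝ) : energyForm β w φ = energyForm β φ w := by
  simp only [energyForm, real_inner_comm]

theorem energyForm_zero_left (φ : E n → ℝ) : energyForm β 0 φ = 0 := by
  simp [energyForm, Dstar]

theorem inner_Dstar (w φ : E n → ℝ) (x y : E n) :
    inner ℝ (Dstar β w x y) (Dstar β φ x y) =
      (w y - w x) * (φ y - φ x) * (‖y - x‖ ^ 2) ^ (-(n + 2 * β) / 2) := by
  rcases eq_or_ne y x with rfl | hne
  · simp [Dstar]
  have hr : 0 < ‖y - x‖ := norm_pos_iff.2 (sub_ne_zero.2 hne)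
  have hpow : (‖y - x‖ ^ 2) ^ (-(n + 2 * β) / 2) =
      ((‖y - x‖ ^ ((n : ℝ) / 2 + β + 1))⁻¹) ^ 2 * ‖y - x‖ ^ 2 := by
    simp only [← Real.rpow_two, ← Real.rpow_neg hr.le, ← Real.rpow_mul hr.le, ← Real.rpow_add hr]
    ring_nf
  rw [hpow, Dstar, Dstar, alpha, inner_smul_left, inner_smul_right, inner_smul_left,
    inner_smul_right, real_inner_self_eq_norm_sq]
  simp only [conj_trivial]
  ring

theorem energyForm_eq_integral_mul_rieszPotential (hβ : 0 ≤ β) (hK : IsCompact K)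
    (hS : IsClosed S) (hKS : Disjoint K S) (hw : Integrable w) (hφ : Integrable φ)
    (hwK : ∀ x ∉ K, w x = 0) (hφS : ∀ y ∉ S, φ y = 0) :
    energyForm β w φ =
      -2 * ∫ y, φ y * rieszPotential (volume.restrict K) (-(n + 2 * β) / 2) w y := by
  set b := -(n + 2 * β) / 2 with hb
  have hb₀ : b ≤ 0 := by rw [hb, neg_div]; exact neg_nonpos.2 (by positivity)
  set F : E n → E n → ℝ := fun x y => w x * φ y * (‖y - x‖ ^ 2) ^ b with hF
  have hint : Integrable (Function.uncurry F) (volume.prod volume) :=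
    integrable_mul_mul_rpow_norm_sub hK hS hKS hw hφ hwK hφS hb₀
  have hwφ (x : E n) : w x * φ x = 0 := by
    by_cases hx : x ∈ K
    · rw [hφS x (disjoint_left.1 hKS hx), mul_zero]
    · rw [hwK x hx, zero_mul]
  have hinner (x y : E n) :
      inner ℝ (Dstar β w x y) (Dstar β φ x y) = -(F x y + F y x) := by
    rw [inner_Dstar, hF]
    simp only [norm_sub_rev x y]
    linear_combination (hwφ x + hwφ y) * (‖y - x‖ ^ 2) ^ b
  have hadd : ∫ x, ∫ y, (F x y + F y x) = (∫ x, ∫ y, F x y) + ∫ x, ∫ y, F y x :=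
    integral_integral_add hint hint.swap
  have hpotential (y : E n) :
      φ y * rieszPotential (volume.restrict K) b w y = ∫ x, F x y := by
    rw [rieszPotential, setIntegral_eq_integral_of_forall_compl_eq_zero fun x hx => by
      rw [hwK x hx, zero_mul], ← integral_const_mul]
    simp only [hF, mul_left_comm (φ y), mul_assoc]
  simp only [energyForm, hinner, integral_neg, hpotential]
  rw [hadd, integral_integral_swap hint]
  ring

theorem memLp_indicator_of_continuousOn {X : Type*} [TopologicalSpace X] [T2Space X]
    [MeasurableSpace X] [OpensMeasurableSpace X] {μ : Measure X} [IsFiniteMeasureOnCompacts μ]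
    {K : Set X} (hK : IsCompact K) {P : X → ℝ} (hP : ContinuousOn P K) (p : ℝ≥0∞) :
    MemLp (K.indicator P) p μ := by
  obtain ⟨C, hC⟩ := hK.exists_bound_of_continuousOn hP
  have : IsFiniteMeasure (μ.restrict K) := isFiniteMeasure_restrict.2 hK.measure_lt_top.ne
  rw [memLp_indicator_iff_restrict hK.measurableSet]
  refine MemLp.of_bound (hP.aestronglyMeasurable_of_isCompact hK hK.measurableSet) C ?_
  filter_upwards [ae_restrict_mem hK.measurableSet] with x hx using hC x hx

theorem exists_inner_eq_energyForm (hβ : 0 ≤ β) (hK : IsCompact K) (hφ : Continuous φ)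
    (hc : HasCompactSupport φ) (hφK : tsupport φ ⊆ Kᶜ) :
    ∃ ψ : L2 n, ∀ w : L2 n, (∀ᵐ x ∂(volume.restrict Kᶜ), w x = 0) →
      inner ℝ ψ w = energyForm β w φ := by
  have hφi : Integrable φ := hφ.integrable_of_hasCompactSupport hc
  set P := rieszPotential (volume.restrict (tsupport φ)) (-(n + 2 * β) / 2) φ
  have hP : ContinuousOn P K :=
    (continuousOn_rieszPotential hc (ae_restrict_mem hc.measurableSet) hφi.integrableOn _).mono
      (subset_compl_comm.1 hφK)
  have hPL := memLp_indicator_of_continuousOn (μ := volume) hK hP 2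
  refine ⟨(-2 : ℝ) • hPL.toLp _, fun w hw => ?_⟩
  have hwi : Integrable (K.indicator w) := (integrable_indicator_iff hK.measurableSet).2
    (((Lp.memLp w).locallyIntegrable one_le_two).integrableOn_isCompact hK)
  rw [energyForm_congr (indicator_ae_eq_of_restrict_compl_ae_eq_zero hK.measurableSet hw).symm
      EventuallyEq.rfl, energyForm_comm, energyForm_eq_integral_mul_rieszPotential hβ hc hK.isClosed
      (disjoint_right.2 fun x hx hφx => hφK hφx hx) hφi hwi
      (fun x => image_eq_zero_of_notMem_tsupport) (fun x hx => indicator_of_notMem hx _),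
    inner_smul_left, L2.inner_def]
  congr 1
  refine integral_congr_ae ?_
  filter_upwards [hPL.coeFn_toLp] with x hx
  rw [hx]
  by_cases hxK : x ∈ K <;> simp [hxK, P]

theorem ae_eq_zero_of_energyForm_eq_zero [NeZero n] (hβ : 0 < β) (hK : IsCompact K)
    (hw : IntegrableOn w K) (hwK : ∀ᵐ x ∂(volume.restrict Kᶜ), w x = 0)
    (h : ∀ φ : E n → ℝ, ContDiff ℝ ∞ φ → HasCompactSupport φ → tsupport φ ⊆ Kᶜ →
      ∫ x, φ x = 0 → energyForm β w φ = 0) : w =ᵐ[volume] 0 := by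
  have hmem : ∀ᵐ x ∂(volume.restrict K), x ∈ K := ae_restrict_mem hK.measurableSet
  have hae := indicator_ae_eq_of_restrict_compl_ae_eq_zero hK.measurableSet hwK
  have hint : Integrable (K.indicator w) := (integrable_indicator_iff hK.measurableSet).2 hw
  obtain ⟨c, hconst⟩ := exists_forall_eq_of_integral_mul_eq_zero (μ := volume)
    hK.isClosed.isOpen_compl
    (continuousOn_rieszPotential hK hmem hint.integrableOn (-(n + 2 * β) / 2))
    fun φ hφ hc hφK hφ₀ => by
      have henergy := h φ hφ hc hφK hφ₀
      rw [energyForm_congr hae.symm EventuallyEq.rfl,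
        energyForm_eq_integral_mul_rieszPotential hβ.le hK (isClosed_tsupport φ)
          (disjoint_right.2 fun x hx => hφK hx) hint
          (hφ.continuous.integrable_of_hasCompactSupport hc)
          (fun x hx => indicator_of_notMem hx _)
          (fun x => image_eq_zero_of_notMem_tsupport)] at henergy
      exact (mul_eq_zero.1 henergy).resolve_left (by norm_num)
  have hzero := ae_eq_zero_of_rieszPotential_const hK hmem hint.integrableOn
    (by linarith [n.cast_nonneg (α := ℝ)]) (by rw [finrank_euclideanSpace_fin]; linarith) hconst
  refine hae.symm.trans ?_
  rw [EventuallyEq, ae_restrict_iff' hK.measurableSet] at hzero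
  filter_upwards [hzero] with x hx
  by_cases hxK : x ∈ K
  · exact hx hxK
  · exact indicator_of_notMem hxK w

end Energy

section Solutions

theorem ae_forall_mem_inner_eq_zero {H X : Type*} [NormedAddCommGroup H] [InnerProductSpace ℝ H]
    [TopologicalSpace.SeparableSpace H] [MeasurableSpace X] {ν : Measure X} {u : X → H} {S : Set H}
    (h : ∀ ψ ∈ S, ∀ᵐ t ∂ν, inner ℝ ψ (u t) = 0) : ∀ᵐ t ∂ν, ∀ ψ ∈ S, inner ℝ ψ (u t) = 0 := by
  obtain ⟨C, hCS, hC, hSC⟩ :=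
    (TopologicalSpace.IsSeparable.of_separableSpace S).exists_countable_dense_subset
  filter_upwards [(ae_ball_iff hC).2 fun ψ hψ => h ψ (hCS hψ)] with t ht
  have hclosed : IsClosed {ψ : H | inner ℝ ψ (u t) = 0} :=
    isClosed_eq (by fun_prop) continuous_const
  exact fun ψ hψ => closure_minimal ht hclosed (hSC hψ)

theorem countable_submonoidClosure {M : Type*} [Monoid M] {s : Set M} (hs : s.Countable) :
    (Submonoid.closure s : Set M).Countable := by
  have := hs.to_subtype
  rw [Submonoid.closure_eq_mrange, MonoidHom.coe_mrange]
  exact countable_range _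

theorem contDiff_of_mem_submonoidClosure {V : Type*} [NormedAddCommGroup V] [NormedSpace ℝ V]
    {s : Set (V → ℝ)} (hs : ∀ g ∈ s, ContDiff ℝ ∞ g) {g : V → ℝ} (hg : g ∈ Submonoid.closure s) :
    ContDiff ℝ ∞ g := by
  induction hg using Submonoid.closure_induction with
  | mem g hg => exact hs g hg
  | one => exact contDiff_const
  | mul g₁ g₂ _ _ hg₁ hg₂ => exact hg₁.mul hg₂

variable {n : ℕ} [NeZero n] {K Ω : Set (E n)}

theorem ae_ae_eq_zero_of_integral_mul_eq_zero {X : Type*} [MeasurableSpace X] {ν : Measure X}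
    (hK : IsCompact K) (hΩK : Ω ⊆ K) {F : E n → X → ℝ}
    (h : ∀ φ : E n → ℝ, ContDiff ℝ ∞ φ → HasCompactSupport φ → ∫ x, φ x = 0 →
      ∀ᵐ t ∂ν, IntegrableOn (fun x => F x t * φ x) Ω ∧ ∫ x in Ω, F x t * φ x = 0) :
    ∀ᵐ t ∂ν, ∀ᵐ x ∂(volume.restrict Ω), F x t = 0 := by
  let coords : Set (E n → ℝ) := range fun i x => x i
  have hsmooth : ∀ g ∈ coords, ContDiff ℝ ∞ g := by
    rintro _ ⟨i, rfl⟩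
    fun_prop
  have hmem : ∀ᵐ x ∂(volume.restrict Ω), x ∈ K :=
    ae_restrict_of_ae_restrict_of_subset hΩK (ae_restrict_mem hK.measurableSet)
  have hmonomial : ∀ g ∈ Submonoid.closure coords, ∀ᵐ t ∂ν,
      IntegrableOn (fun x => F x t * g x) Ω ∧ ∫ x in Ω, F x t * g x = 0 := by
    intro g hg
    obtain ⟨φ, hφ, hc, hφ₀, hφg⟩ := exists_contDiff_integral_eq_zero_eqOn (μ := volume) hK
      (contDiff_of_mem_submonoidClosure hsmooth hg)
    filter_upwards [h φ hφ hc hφ₀] with t ht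
    have hcongr : (fun x => F x t * φ x) =ᵐ[volume.restrict Ω] fun x => F x t * g x := by
      filter_upwards [hmem] with x hx
      rw [hφg hx]
    exact ⟨ht.1.congr hcongr, (integral_congr_ae hcongr).symm.trans ht.2⟩
  filter_upwards [(ae_ball_iff (countable_submonoidClosure (countable_range _))).2 hmonomial]
    with t ht
  have hint : IntegrableOn (fun x => F x t) Ω := by
    simpa only [Pi.one_apply, mul_one] using (ht 1 (one_mem _)).1
  refine ae_eq_zero_of_forall_mem_closure hK hmem hint
    (fun g hg => (hsmooth g hg).continuous.continuousOn) (fun x _ y _ hxy => ?_)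
    fun g hg => (ht g hg).2
  obtain ⟨i, hi⟩ : ∃ i, x i ≠ y i := by
    by_contra! hall
    exact hxy (PiLp.ext hall)
  exact ⟨_, ⟨i, rfl⟩, hi⟩

theorem IsWeakTimeDeriv.ae_eq_zero {X : Type*} [NormedAddCommGroup X] [NormedSpace ℝ X]
    [CompleteSpace X] {T t₀ : ℝ} {w w' : ℝ → X} (h : IsWeakTimeDeriv T w w') (ht₀T : t₀ ≤ T)
    (hw : ∀ᵐ t ∂(volume.restrict (Ioo 0 t₀)), w t = 0) :
    ∀ᵐ t ∂(volume.restrict (Ioo 0 t₀)), w' t = 0 := by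
  have hsub : Ioo 0 t₀ ⊆ Ioo 0 T := Ioo_subset_Ioo_right ht₀T
  have hint : IntegrableOn w' (Ioo 0 T) := h.memLp_deriv.integrable one_le_two
  rw [ae_restrict_iff' measurableSet_Ioo] at hw ⊢
  refine isOpen_Ioo.ae_eq_zero_of_integral_contDiff_smul_eq_zero
    (hint.mono_set hsub).locallyIntegrableOn fun η hη hηc hηs => ?_
  have hleft : ∫ t in Ioo 0 T, deriv η t • w t = 0 := by
    refine integral_eq_zero_of_ae (ae_restrict_of_ae ?_)
    filter_upwards [hw] with t hwt
    by_cases ht : t ∈ Ioo 0 t₀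
    · rw [hwt ht, smul_zero, Pi.zero_apply]
    · rw [image_eq_zero_of_notMem_tsupport fun hm => ht (hηs (tsupport_deriv_subset hm)),
        zero_smul, Pi.zero_apply]
  have hright : ∫ t in Ioo 0 T, η t • w' t = ∫ t, η t • w' t := by
    refine setIntegral_eq_integral_of_forall_compl_eq_zero fun t ht => ?_
    rw [image_eq_zero_of_notMem_tsupport fun hm => ht (hsub (hηs hm)), zero_smul]
  have hparts := h.integral_eq η hη hηc (hηs.trans hsub)
  rw [hleft, hright] at hparts
  exact neg_eq_zero.1 hparts.symm

/-- Variational solutions of `∂ₜu + 𝒟(𝒟*u) = F` in `Ω × (0,T)` with `𝒩(𝒟*u) = 0` outside `Ω`, for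
an arbitrary set `Ω` and a source `F` that may depend on every coordinate; `u'` is the time
derivative of `u` on `Ω`. -/
def IsVariationalSolution {n : ℕ} (β T : ℝ) (Ω : Set (E n)) (F : E n → ℝ → ℝ) (u : ℝ → L2 n)
    (u' : ℝ → L2On Ω) : Prop :=
  ∀ φ : L2 n, MemHc β φ → ∀ᵐ t ∂(volume.restrict (Ioo 0 T)),
    IntegrableOn (fun x => F x t * φ x) Ω ∧
      (∫ x in Ω, u' t x * φ x) + energyForm β (u t) φ = ∫ x in Ω, F x t * φ x

namespace IsVariationalSolution

variable {β T t₀ : ℝ} {F : E n → ℝ → ℝ} {u : ℝ → L2 n} {u' : ℝ → L2On Ω}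

theorem ae_of_contDiff (hsol : IsVariationalSolution β T Ω F u u') (hβ₀ : 0 < β) (hβ₁ : β < 1)
    (ht₀T : t₀ ≤ T) {φ : E n → ℝ} (hφ : ContDiff ℝ ∞ φ) (hc : HasCompactSupport φ)
    (hφ₀ : ∫ x, φ x = 0) :
    ∀ᵐ t ∂(volume.restrict (Ioo 0 t₀)), IntegrableOn (fun x => F x t * φ x) Ω ∧
      (∫ x in Ω, u' t x * φ x) + energyForm β (u t) φ = ∫ x in Ω, F x t * φ x := by
  have hL2 : MemLp φ 2 volume := hφ.continuous.memLp_of_hasCompactSupport hc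
  have hmul (g : E n → ℝ) :
      (fun x => g x * hL2.toLp φ x) =ᵐ[volume.restrict Ω] fun x => g x * φ x := by
    filter_upwards [ae_restrict_of_ae hL2.coeFn_toLp] with x hx
    rw [hx]
  filter_upwards [ae_restrict_of_ae_restrict_of_subset (Ioo_subset_Ioo_right ht₀T)
    (hsol _ (memHc_toLp hβ₀ hβ₁ hφ hc hφ₀))] with t ⟨hint, heq⟩
  rw [integral_congr_ae (hmul _), integral_congr_ae (hmul _),
    energyForm_congr EventuallyEq.rfl hL2.coeFn_toLp] at heq
  exact ⟨hint.congr (hmul _), heq⟩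

theorem ae_eq_zero (hsol : IsVariationalSolution β T Ω F u u') (hβ₀ : 0 < β) (hβ₁ : β < 1)
    (ht₀T : t₀ ≤ T) (hK : IsCompact K) (hΩK : Ω ⊆ K)
    (hvanish : ∀ᵐ t ∂(volume.restrict (Ioo 0 t₀)), ∀ᵐ x ∂(volume.restrict Kᶜ), u t x = 0) :
    ∀ᵐ t ∂(volume.restrict (Ioo 0 t₀)), u t = 0 := by
  let exteriorTests : Set (E n → ℝ) := {φ | ContDiff ℝ ∞ φ ∧ HasCompactSupport φ ∧
    tsupport φ ⊆ Kᶜ ∧ ∫ x, φ x = 0}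
  let represents (ψ : L2 n) (φ : E n → ℝ) : Prop := ∀ w : L2 n,
    (∀ᵐ x ∂(volume.restrict Kᶜ), w x = 0) → inner ℝ ψ w = energyForm β w φ
  have horth : ∀ ψ ∈ {ψ | ∃ φ ∈ exteriorTests, represents ψ φ},
      ∀ᵐ t ∂(volume.restrict (Ioo 0 t₀)), inner ℝ ψ (u t) = 0 := by
    rintro ψ ⟨φ, ⟨hφ, hc, hφK, hφ₀⟩, hψ⟩
    have hΩφ (g : E n → ℝ) : ∫ x in Ω, g x * φ x = 0 :=
      setIntegral_eq_zero_of_forall_eq_zero fun x hx => by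
        rw [image_eq_zero_of_notMem_tsupport fun hxφ => hφK hxφ (hΩK hx), mul_zero]
    filter_upwards [hsol.ae_of_contDiff hβ₀ hβ₁ ht₀T hφ hc hφ₀, hvanish] with t ⟨_, ht⟩ hut
    rwa [hΩφ, hΩφ, zero_add, ← hψ _ hut] at ht
  -- Each test function has its own null set of times; the separability of `L²` makes it uniform.
  have : Fact ((2 : ℝ≥0∞) ≠ ⊤) := ⟨ENNReal.ofNat_ne_top⟩
  filter_upwards [ae_forall_mem_inner_eq_zero horth, hvanish] with t ht hut
  refine Lp.eq_zero_iff_ae_eq_zero.2 (ae_eq_zero_of_energyForm_eq_zero hβ₀ hK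
    (((Lp.memLp (u t)).locallyIntegrable one_le_two).integrableOn_isCompact hK) hut
    fun φ hφ hc hφK hφ₀ => ?_)
  obtain ⟨ψ, hψ⟩ := exists_inner_eq_energyForm hβ₀.le hK hφ.continuous hc hφK
  rw [← hψ _ hut]
  exact ht ψ ⟨φ, ⟨hφ, hc, hφK, hφ₀⟩, hψ⟩

theorem ae_integral_mul_eq_zero (hsol : IsVariationalSolution β T Ω F u u') (hβ₀ : 0 < β)
    (hβ₁ : β < 1) (ht₀T : t₀ ≤ T) (hu : ∀ᵐ t ∂(volume.restrict (Ioo 0 t₀)), u t = 0)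
    (hu' : ∀ᵐ t ∂(volume.restrict (Ioo 0 t₀)), u' t = 0) {φ : E n → ℝ} (hφ : ContDiff ℝ ∞ φ)
    (hc : HasCompactSupport φ) (hφ₀ : ∫ x, φ x = 0) :
    ∀ᵐ t ∂(volume.restrict (Ioo 0 t₀)),
      IntegrableOn (fun x => F x t * φ x) Ω ∧ ∫ x in Ω, F x t * φ x = 0 := by
  filter_upwards [hsol.ae_of_contDiff hβ₀ hβ₁ ht₀T hφ hc hφ₀, hu, hu'] with t ⟨hint, heq⟩ hut hut'
  have hderiv : ∫ x in Ω, u' t x * φ x = 0 := by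
    refine integral_eq_zero_of_ae ?_
    filter_upwards [Lp.eq_zero_iff_ae_eq_zero.1 hut'] with x hx
    rw [hx]
    exact zero_mul (φ x)
  rw [hderiv, energyForm_congr (Lp.eq_zero_iff_ae_eq_zero.1 hut) EventuallyEq.rfl,
    energyForm_zero_left, zero_add] at heq
  exact ⟨hint, heq.symm⟩

end IsVariationalSolution

end Solutions

section Cylinder

variable {m : ℕ} {ℓ : ℝ} {D : Set (E m)}

theorem norm_sq_eq_tailCoord (x : E (m + 1)) : ‖x‖ ^ 2 = x 0 ^ 2 + ‖tailCoord x‖ ^ 2 := by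
  rw [EuclideanSpace.real_norm_sq_eq, EuclideanSpace.real_norm_sq_eq, Fin.sum_univ_succ]
  rfl

theorem isBounded_cylinder (ℓ : ℝ) (hD : Bornology.IsBounded D) :
    Bornology.IsBounded (cylinder ℓ D) := by
  obtain ⟨C, hC⟩ := hD.exists_norm_le
  refine isBounded_iff_forall_norm_le.2 ⟨√(ℓ ^ 2 + C ^ 2), fun x ⟨⟨hx₀, hxℓ⟩, hxD⟩ => ?_⟩
  rw [← abs_norm]
  refine Real.abs_le_sqrt ?_
  rw [norm_sq_eq_tailCoord]
  gcongr
  exact hC _ hxD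

theorem volume_cylinder (ℓ : ℝ) (D : Set (E m)) :
    volume (cylinder ℓ D) = ENNReal.ofReal ℓ * volume D := by
  let e : E (m + 1) ≃ᵐ ℝ × E m :=
    (MeasurableEquiv.toLp 2 (Fin (m + 1) → ℝ)).symm.trans
      ((MeasurableEquiv.piFinSuccAbove (fun _ => ℝ) 0).trans
        ((MeasurableEquiv.refl ℝ).prodCongr (MeasurableEquiv.toLp 2 (Fin m → ℝ))))
  have he : MeasurePreserving e volume (volume.prod volume) :=
    (EuclideanSpace.volume_preserving_symm_measurableEquiv_toLp (Fin (m + 1))).trans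
      ((volume_preserving_piFinSuccAbove (fun _ => ℝ) 0).trans
        ((MeasurePreserving.id volume).prod (PiLp.volume_preserving_toLp (Fin m))))
  have hpreimage : cylinder ℓ D = e ⁻¹' (Ioo 0 ℓ ×ˢ D) := rfl
  rw [hpreimage, he.measure_preimage_equiv, Measure.prod_prod, Real.volume_Ioo, sub_zero]

theorem ae_restrict_of_ae_restrict_cylinder (hℓ : 0 < ℓ) (hD : MeasurableSet D) {p : E m → Prop}
    (h : ∀ᵐ x ∂(volume.restrict (cylinder ℓ D)), p (tailCoord x)) :
    ∀ᵐ x ∂(volume.restrict D), p x := by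
  have hnull : volume (cylinder ℓ {x | x ∈ D ∧ ¬p x}) = 0 := by
    refine measure_mono_null ?_ (ae_iff.1 (ae_imp_of_ae_restrict h))
    exact fun x ⟨hx₀, hxD, hxp⟩ himp => hxp (himp ⟨hx₀, hxD⟩)
  rw [volume_cylinder, mul_eq_zero, ENNReal.ofReal_eq_zero] at hnull
  rw [ae_restrict_iff' hD, ae_iff]
  simpa only [Classical.not_imp] using hnull.resolve_left hℓ.not_ge

theorem ae_prod_of_ae_ae_swap {X Y Z : Type*} [MeasurableSpace X] [MeasurableSpace Y]
    {μ : Measure X} {ν : Measure Y} [SFinite μ] [SFinite ν] [TopologicalSpace Z]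
    [TopologicalSpace.MetrizableSpace Z] {g : X × Y → Z} {c : Z}
    (hg : AEStronglyMeasurable g (μ.prod ν)) (h : ∀ᵐ y ∂ν, ∀ᵐ x ∂μ, g (x, y) = c) :
    ∀ᵐ p ∂(μ.prod ν), g p = c := by
  have hset : MeasurableSet {p | hg.mk g p = c} :=
    hg.stronglyMeasurable_mk.measurableSet_eq_fun stronglyMeasurable_const
  have hswap := Measure.ae_ae_of_ae_prod
    (Measure.measurePreserving_swap.quasiMeasurePreserving.ae hg.ae_eq_mk)
  have hmk : ∀ᵐ y ∂ν, ∀ᵐ x ∂μ, hg.mk g (x, y) = c := by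
    filter_upwards [h, hswap] with y hy hmky
    filter_upwards [hy, hmky] with x hx hmkx using hmkx.symm.trans hx
  filter_upwards [hg.ae_eq_mk, (Measure.ae_prod_iff_ae_ae hset).2 ((Measure.ae_ae_comm hset).2 hmk)]
    with p hp hmkp using hp.trans hmkp

end Cylinder

end NonlocalDiffusion

end

theorem theorem4p2_general {n : ℕ} [NeZero n] {β T t₀ : ℝ} (hβ₀ : 0 < β) (hβ₁ : β < 1)
    (ht₀T : t₀ ≤ T) {K Ω : Set (NonlocalDiffusion.E n)} (hK : IsCompact K) (hΩK : Ω ⊆ K)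
    {F : NonlocalDiffusion.E n → ℝ → ℝ} {u : ℝ → NonlocalDiffusion.L2 n}
    {u' : ℝ → NonlocalDiffusion.L2On Ω}
    (hu_time : NonlocalDiffusion.IsWeakTimeDeriv T
      (fun t => NonlocalDiffusion.restrictL2 Ω (u t)) u')
    (hsol : NonlocalDiffusion.IsVariationalSolution β T Ω F u u')
    (hvanish : ∀ᵐ t ∂(volume.restrict (Ioo 0 t₀)), ∀ᵐ x ∂(volume.restrict Kᶜ), u t x = 0) :
    ∀ᵐ t ∂(volume.restrict (Ioo 0 t₀)), ∀ᵐ x ∂(volume.restrict Ω), F x t = 0 := by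
  have hu := hsol.ae_eq_zero hβ₀ hβ₁ ht₀T hK hΩK hvanish
  have hu' := hu_time.ae_eq_zero ht₀T <| hu.mono fun t ht => by
    rw [ht, NonlocalDiffusion.restrictL2, map_zero]
  exact NonlocalDiffusion.ae_ae_eq_zero_of_integral_mul_eq_zero hK hΩK fun _ hφ hc hφ₀ =>
    hsol.ae_integral_mul_eq_zero hβ₀ hβ₁ ht₀T hu hu' hφ hc hφ₀

theorem theorem4p2 {m : ℕ} (β ℓ T t₀ : ℝ) (hβ₀ : 0 < β) (hβ₁ : β < 1) (hℓ : 0 < ℓ)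
    (ht₀ : 0 < t₀) (ht₀T : t₀ ≤ T)
    (D : Set (NonlocalDiffusion.E m)) (hDo : IsOpen D) (hDb : Bornology.IsBounded D)
    (f : NonlocalDiffusion.E m → ℝ → ℝ)
    (hf : AEStronglyMeasurable (fun p : NonlocalDiffusion.E m × ℝ => f p.1 p.2)
      ((volume.restrict D).prod (volume.restrict (Ioo 0 T))))
    (u v : ℝ → NonlocalDiffusion.L2 (m + 1))
    (u' v' : ℝ → NonlocalDiffusion.L2On (NonlocalDiffusion.cylinder ℓ D))
    (hv : ∀ t ∈ Icc 0 T, NonlocalDiffusion.IsWeakDerivFirst (u t) (v t))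
    (hu_cont : NonlocalDiffusion.ContinuousInH β T u)
    (hv_cont : NonlocalDiffusion.ContinuousInH β T v)
    (hu_time : NonlocalDiffusion.IsWeakTimeDeriv T
      (fun t => NonlocalDiffusion.restrictL2 (NonlocalDiffusion.cylinder ℓ D) (u t)) u')
    (hv_time : NonlocalDiffusion.IsWeakTimeDeriv T
      (fun t => NonlocalDiffusion.restrictL2 (NonlocalDiffusion.cylinder ℓ D) (v t)) v')
    (hsol : NonlocalDiffusion.IsSolution β ℓ T D f u u')
    (hvanish : ∀ t ∈ Ioo 0 t₀,
      ∀ᵐ x ∂(volume.restrict (NonlocalDiffusion.cylinder ℓ D)ᶜ), u t x = 0) :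
    ∀ᵐ p ∂((volume.restrict D).prod (volume.restrict (Ioo 0 t₀))), f p.1 p.2 = 0 := by
  have hK := (NonlocalDiffusion.isBounded_cylinder ℓ hDb).isCompact_closure
  have hf₀ : AEStronglyMeasurable (fun p : NonlocalDiffusion.E m × ℝ => f p.1 p.2)
      ((volume.restrict D).prod (volume.restrict (Ioo 0 t₀))) :=
    hf.mono_measure (Measure.prod_mono le_rfl
      (Measure.restrict_mono (Ioo_subset_Ioo_right ht₀T) le_rfl))
  refine NonlocalDiffusion.ae_prod_of_ae_ae_swap hf₀ ?_
  have hslice := theorem4p2_general hβ₀ hβ₁ ht₀T hK subset_closure hu_time hsol.variational <|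
    (ae_restrict_mem measurableSet_Ioo).mono fun t ht =>
      ae_restrict_of_ae_restrict_of_subset (compl_subset_compl.2 subset_closure) (hvanish t ht)
  exact hslice.mono fun t ht =>
    NonlocalDiffusion.ae_restrict_of_ae_restrict_cylinder hℓ hDo.measurableSet ht
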